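/- Let $k=\mathbb C$ or $k=\mathbb R$. All Lie groups are finite-dimensional (analytic) Lie groups over $k$, Hausdorff and second countable; in particular, for $k=\mathbb C$ they are complex Lie groups and morphisms between them are holomorphic. A pair $(\mathfrak g_1,\mathfrak g_2)$ is a matched pair of Lie algebras over $k$ if $\mathfrak g_1,\mathfrak g_2$ are Lie subalgebras of a Lie algebra $\mathfrak g$ over $k$ with $\mathfrak g=\mathfrak g_1\oplus\mathfrak g_2$ as vector spaces. A pair $(G_1,G_2)$ of Lie groups over $k$ is a matched pair of Lie groups if there are a Lie group $G$ over $k$, a homomorphism $i:G_1\to G$ and an anti-homomorphism $j:G_2\to G$ of Lie groups over $k$, both having closed image and being homeomorphisms onto their images, such that $i(G_1)\cap j(G_2)=\{e\}$ and the complement of $i(G_1)\,j(G_2)$ in $G$ has Haar measure zero. A matched pair $(\mathfrak g_1,\mathfrak g_2)$ of Lie algebras in $\mathfrak g$ can be exponentiated to a matched pair of Lie groups $(G_1,G_2)$ if $G,i,j$ as above can be chosen such that there is an isomorphism of Lie algebras over $k$ from the Lie algebra of $G$ onto $\mathfrak g$ that sends the Lie algebra of the closed subgroup $i(G_1)$ onto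 $\mathfrak g_1$ and the Lie algebra of the closed subgroup $j(G_2)$ onto $\mathfrak g_2$. **Proposition.** (1) Every matched pair $(\mathfrak g_1,\mathfrak g_2)$ of complex Lie algebras with $\dim_{\mathbb C}\mathfrak g_1=\dim_{\mathbb C}\mathfrak g_2=1$ (that is, $\mathfrak g_1=\mathfrak g_2=\mathbb C$) can be exponentiated to a matched pair of complex Lie groups $(G_1,G_2)$ in which each of $G_1,G_2$ is either $(\mathbb C,+)$ or $(\mathbb C\setminus\{0\},\cdot)$. (2) Every matched pair $(\mathfrak g_1,\mathfrak g_2)$ of real Lie algebras with $\dim_{\mathbb R}\mathfrak g_1=\dim_{\mathbb R}\mathfrak g_2=1$ (that is, $\mathfrak g_1=\mathfrak g_2=\mathbb R$) can be exponentiated to a matched pair of real Lie groups $(G_1,G_2)$ in which each of $G_1,G_2$ is either $(\mathbb R,+)$ or $(\mathbb R\setminus\{0\},\cdot)$. -/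

import Mathlib

open scoped Manifold ContDiff
open MeasureTheory

noncomputable section

namespace LieMatchedPair

/-! ### The additive group `(𝕜, +)` as a Lie group

`Multiplicative 𝕜` is Mathlib's multiplicatively written copy of `(𝕜, +)`; it is given the manifold
structure of `𝕜` (one global chart, the identity).  The multiplicative group `𝕜 ∖ {0}` is `𝕜ˣ`,
whose Lie group structure (as an open subset of `𝕜`) is in Mathlib. -/

section Additive

variable {𝕜 : Type*} [NontriviallyNormedField 𝕜]

theorem isOpenEmbedding_toAdd :
    Topology.IsOpenEmbedding (Multiplicative.toAdd : Multiplicative 𝕜 → 𝕜) :=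
  (Homeomorph.refl 𝕜).isOpenEmbedding

instance instChartedSpaceMultiplicative : ChartedSpace 𝕜 (Multiplicative 𝕜) :=
  isOpenEmbedding_toAdd.singletonChartedSpace

instance instIsManifoldMultiplicative {n : WithTop ℕ∞} :
    IsManifold 𝓘(𝕜, 𝕜) n (Multiplicative 𝕜) :=
  isOpenEmbedding_toAdd.isManifold_singleton

theorem contMDiff_toAdd {n : WithTop ℕ∞} :
    ContMDiff 𝓘(𝕜, 𝕜) 𝓘(𝕜, 𝕜) n (Multiplicative.toAdd : Multiplicative 𝕜 → 𝕜) :=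
  contMDiff_isOpenEmbedding isOpenEmbedding_toAdd

instance instLieGroupMultiplicative {n : WithTop ℕ∞} :
    LieGroup 𝓘(𝕜, 𝕜) n (Multiplicative 𝕜) where
  contMDiff_mul := by
    apply ContMDiff.of_comp_isOpenEmbedding isOpenEmbedding_toAdd
    exact (contMDiff_toAdd.comp contMDiff_fst).add (contMDiff_toAdd.comp contMDiff_snd)
  contMDiff_inv := by
    apply ContMDiff.of_comp_isOpenEmbedding isOpenEmbedding_toAdd
    exact contMDiff_toAdd.neg

end Additive

/-- `(𝔤₁, 𝔤₂)` is a matched pair of Lie algebras: Lie subalgebras of `𝔤` with `𝔤 = 𝔤₁ ⊕ 𝔤₂` as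
vector spaces. -/
def IsMatchedPairLieAlgebra {𝕜 : Type*} [Field 𝕜] {𝔤 : Type*} [LieRing 𝔤] [LieAlgebra 𝕜 𝔤]
    (𝔤₁ 𝔤₂ : LieSubalgebra 𝕜 𝔤) : Prop :=
  IsCompl 𝔤₁.toSubmodule 𝔤₂.toSubmodule

section Groups

variable {𝕜 : Type*} [RCLike 𝕜]
  {E : Type*} [NormedAddCommGroup E] [NormedSpace 𝕜 E]
  {E₁ : Type*} [NormedAddCommGroup E₁] [NormedSpace 𝕜 E₁]
  {E₂ : Type*} [NormedAddCommGroup E₂] [NormedSpace 𝕜 E₂]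
  {G : Type*} [Group G] [TopologicalSpace G] [ChartedSpace E G] [MeasurableSpace G]
  {G₁ : Type*} [Group G₁] [TopologicalSpace G₁] [ChartedSpace E₁ G₁]
  {G₂ : Type*} [Group G₂] [TopologicalSpace G₂] [ChartedSpace E₂ G₂]

/-- The Lie groups `G₁`, `G₂` form a matched pair of Lie groups inside the Lie group `G` (which
carries its Borel σ-algebra) through the morphism `i : G₁ → G` and the anti-morphism `j : G₂ → G`
of Lie groups over `𝕜`. -/
structure IsMatchedPairLieGroup (i : G₁ → G) (j : G₂ → G) : Prop where
  map_mul_left : ∀ g h : G₁, i (g * h) = i g * i h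
  map_mul_right : ∀ s t : G₂, j (s * t) = j t * j s
  contMDiff_left : ContMDiff 𝓘(𝕜, E₁) 𝓘(𝕜, E) ω i
  contMDiff_right : ContMDiff 𝓘(𝕜, E₂) 𝓘(𝕜, E) ω j
  isClosedEmbedding_left : Topology.IsClosedEmbedding i
  isClosedEmbedding_right : Topology.IsClosedEmbedding j
  range_inter_range : Set.range i ∩ Set.range j = {1}
  null_compl : ∀ μ : Measure G, μ.IsHaarMeasure →
    μ (Set.range fun p : G₁ × G₂ => i p.1 * j p.2)ᶜ = 0

/-- The tangent space at `1` of the image of `f : G₁ → G`, for `f` smooth with `f 1 = 1`: the range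
of the derivative of `f` at `1`, inside the Lie algebra `T₁ G` of `G`. When `f` is an injective
morphism or anti-morphism of Lie groups with closed image, it is the Lie algebra of the closed
subgroup `f(G₁)`. -/
def tangentImage (f : G₁ → G) : Set (GroupLieAlgebra 𝓘(𝕜, E) G) :=
  Set.range fun w : TangentSpace 𝓘(𝕜, E₁) (1 : G₁) =>
    (mfderiv 𝓘(𝕜, E₁) 𝓘(𝕜, E) f 1 w : TangentSpace 𝓘(𝕜, E) (f 1))

end Groups

/-- The matched pair `(𝔤₁, 𝔤₂)` of Lie algebras (inside `𝔤`) can be exponentiated to a matched pair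
of Lie groups `(G₁, G₂)`: there are a (second countable, Hausdorff, finite-dimensional) Lie group
`G` over `𝕜` and maps `i`, `j` that make `(G₁, G₂)` a matched pair of Lie groups, and an
isomorphism of the Lie algebra of `G` onto `𝔤` which sends the Lie algebra of `i(G₁)` onto `𝔤₁` and
that of `j(G₂)` onto `𝔤₂`. -/
def ExponentiatesTo {𝕜 : Type} [RCLike 𝕜] {𝔤 : Type*} [LieRing 𝔤] [LieAlgebra 𝕜 𝔤]
    (𝔤₁ 𝔤₂ : LieSubalgebra 𝕜 𝔤)
    {E₁ : Type*} [NormedAddCommGroup E₁] [NormedSpace 𝕜 E₁]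
    {E₂ : Type*} [NormedAddCommGroup E₂] [NormedSpace 𝕜 E₂]
    (G₁ : Type*) [Group G₁] [TopologicalSpace G₁] [ChartedSpace E₁ G₁] [LieGroup 𝓘(𝕜, E₁) ω G₁]
    (G₂ : Type*) [Group G₂] [TopologicalSpace G₂] [ChartedSpace E₂ G₂] [LieGroup 𝓘(𝕜, E₂) ω G₂] :
    Prop :=
  ∃ (E : Type) (_ : NormedAddCommGroup E) (_ : NormedSpace 𝕜 E) (_ : FiniteDimensional 𝕜 E)
    (_ : CompleteSpace E)
    (G : Type) (_ : Group G) (_ : TopologicalSpace G) (_ : ChartedSpace E G)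
    (_ : LieGroup 𝓘(𝕜, E) ω G) (_ : T2Space G) (_ : SecondCountableTopology G)
    (_ : MeasurableSpace G) (_ : BorelSpace G)
    (i : G₁ → G) (j : G₂ → G) (φ : GroupLieAlgebra 𝓘(𝕜, E) G ≃ₗ⁅𝕜⁆ 𝔤),
    IsMatchedPairLieGroup (𝕜 := 𝕜) (E := E) (E₁ := E₁) (E₂ := E₂) i j ∧
    φ '' tangentImage (𝕜 := 𝕜) (E := E) (E₁ := E₁) i = (𝔤₁ : Set 𝔤) ∧
    φ '' tangentImage (𝕜 := 𝕜) (E := E) (E₁ := E₂) j = (𝔤₂ : Set 𝔤)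

/-- `(𝔤₁, 𝔤₂)` can be exponentiated to a matched pair of Lie groups `(G₁, G₂)` where each of `G₁`
and `G₂` is either `(𝕜, +)` or `(𝕜 ∖ {0}, ·)`. -/
def ExponentiatesToAddOrMul {𝕜 : Type} [RCLike 𝕜] {𝔤 : Type*} [LieRing 𝔤] [LieAlgebra 𝕜 𝔤]
    (𝔤₁ 𝔤₂ : LieSubalgebra 𝕜 𝔤) : Prop :=
  ExponentiatesTo 𝔤₁ 𝔤₂ (E₁ := 𝕜) (E₂ := 𝕜) (Multiplicative 𝕜) (Multiplicative 𝕜) ∨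
  ExponentiatesTo 𝔤₁ 𝔤₂ (E₁ := 𝕜) (E₂ := 𝕜) (Multiplicative 𝕜) 𝕜ˣ ∨
  ExponentiatesTo 𝔤₁ 𝔤₂ (E₁ := 𝕜) (E₂ := 𝕜) 𝕜ˣ (Multiplicative 𝕜) ∨
  ExponentiatesTo 𝔤₁ 𝔤₂ (E₁ := 𝕜) (E₂ := 𝕜) 𝕜ˣ 𝕜ˣ

end LieMatchedPair

end

/-!
In a two-dimensional Lie algebra the bracket is `⁅x, y⁆ = ℓ x • y - ℓ y • x` for a linear form `ℓ`.
On any vector space `E` this bracket is the one of the group of all `p : E` with `1 + ℓ p ≠ 0`,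
where `p * q = p + (1 + ℓ p) • q`, and the subgroup with Lie algebra `F ⊆ E` is cut out by `F`.
For a line `F` spanned by `v`, this subgroup is `(𝕜, +)` if `ℓ v = 0` and `(𝕜 ∖ {0}, ·)` otherwise,
through the character `1 + ℓ`.

If `E = F₁ ⊕ F₂`, then `p = x + y` factors as `x * ((1 + ℓ x)⁻¹ • y)` unless `ℓ x = -1`. The
exceptional hyperplane is empty or a coset of a proper closed subgroup, which is null because a
subgroup of positive Haar measure is open.
-/

namespace LieMatchedPair

open Topology
open scoped Pointwise

section LieAlgebra

variable {𝕜 𝔤 : Type*} [Field 𝕜] [LieRing 𝔤] [LieAlgebra 𝕜 𝔤]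

theorem IsMatchedPairLieAlgebra.finrank_add_finrank {𝔤₁ 𝔤₂ : LieSubalgebra 𝕜 𝔤}
    [FiniteDimensional 𝕜 𝔤₁] [FiniteDimensional 𝕜 𝔤₂] (h : IsMatchedPairLieAlgebra 𝔤₁ 𝔤₂) :
    Module.finrank 𝕜 𝔤₁ + Module.finrank 𝕜 𝔤₂ = Module.finrank 𝕜 𝔤 := by
  rw [← Module.finrank_prod]
  exact (Submodule.prodEquivOfIsCompl _ _ h).finrank_eq

theorem exists_lie_eq_smul_sub_smul (h : Module.finrank 𝕜 𝔤 = 2) :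
    ∃ ℓ : 𝔤 →ₗ[𝕜] 𝕜, ∀ x y : 𝔤, ⁅x, y⁆ = ℓ x • y - ℓ y • x := by
  have : FiniteDimensional 𝕜 𝔤 := Module.finite_of_finrank_eq_succ h
  let b := Module.finBasisOfFinrankEq 𝕜 𝔤 h
  have expand (x : 𝔤) : x = b.repr x 0 • b 0 + b.repr x 1 • b 1 := by
    simpa only [Fin.sum_univ_two] using (b.sum_repr x).symm
  let c := b.repr ⁅b 0, b 1⁆
  have lie_basis : ⁅b 0, b 1⁆ = c 0 • b 0 + c 1 • b 1 := expand _
  refine ⟨c 1 • b.coord 0 - c 0 • b.coord 1, fun x y => ?_⟩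
  simp only [LinearMap.sub_apply, LinearMap.smul_apply, Module.Basis.coord_apply, smul_eq_mul]
  generalize hx : b.repr x = x', hy : b.repr y = y'
  rw [expand x, expand y, hx, hy]
  simp only [add_lie, lie_add, smul_lie, lie_smul, lie_self, ← lie_skew (b 1) (b 0), lie_basis]
  module

end LieAlgebra

section GlobalChart

variable {𝕜 : Type*} [NontriviallyNormedField 𝕜]
  {E : Type*} [NormedAddCommGroup E] [NormedSpace 𝕜 E]
  {E' : Type*} [NormedAddCommGroup E'] [NormedSpace 𝕜 E']
  {M : Type*} [TopologicalSpace M] [ChartedSpace E M]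
  {M' : Type*} [TopologicalSpace M'] [ChartedSpace E' M']

theorem mlieBracket_eq_lieBracket (V W : (y : E) → TangentSpace 𝓘(𝕜, E) y) (x : E) :
    (VectorField.mlieBracket 𝓘(𝕜, E) V W x : E) = VectorField.lieBracket 𝕜 V W x := by
  rw [← VectorField.mlieBracketWithin_univ, VectorField.mlieBracketWithin_eq_lieBracketWithin]
  exact congrFun (VectorField.lieBracketWithin_univ (E := E)) x

/-- The map `e` is a global chart of the manifold `M`: it is the preferred chart at each point. Its
image, which need not be all of `E`, identifies each tangent space of `M` with `E` in the way
Mathlib does. -/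
def IsGlobalChart (e : M → E) : Prop := ∀ x, ⇑(chartAt E x) = e

namespace IsGlobalChart

variable {e : M → E} {e' : M' → E'}

theorem coe_extChartAt (he : IsGlobalChart e) (x : M) : ⇑(extChartAt 𝓘(𝕜, E) x) = e := he x

theorem contMDiff {n : WithTop ℕ∞} (he : IsGlobalChart e) :
    ContMDiff 𝓘(𝕜, E) 𝓘(𝕜, E) n e := fun x =>
  he.coe_extChartAt (𝕜 := 𝕜) x ▸ contMDiffAt_extChartAt

theorem hasMFDerivAt_id [IsManifold 𝓘(𝕜, E) 1 M] (he : IsGlobalChart e) (x : M) :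
    HasMFDerivAt 𝓘(𝕜, E) 𝓘(𝕜, E) e x (ContinuousLinearMap.id 𝕜 E) := by
  have hd : mfderiv 𝓘(𝕜, E) 𝓘(𝕜, E) e x = ContinuousLinearMap.id 𝕜 E :=
    he.coe_extChartAt (𝕜 := 𝕜) x ▸ mfderiv_extChartAt_self
  rw [← hd]
  exact (he.contMDiff.mdifferentiable one_ne_zero x).hasMFDerivAt

theorem mfderiv_eq [IsManifold 𝓘(𝕜, E) 1 M] [IsManifold 𝓘(𝕜, E') 1 M']
    (he : IsGlobalChart e) (he' : IsGlobalChart e') {f : M → M'} {F : E → E'} {F' : E →L[𝕜] E'}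
    {x : M} (hf : MDifferentiableAt 𝓘(𝕜, E) 𝓘(𝕜, E') f x) (h : e' ∘ f = F ∘ e)
    (hF : HasFDerivAt F F' (e x)) : mfderiv 𝓘(𝕜, E) 𝓘(𝕜, E') f x = F' := by
  have h₁ := (he'.hasMFDerivAt_id (𝕜 := 𝕜) (f x)).comp x hf.hasMFDerivAt
  have h₂ := hF.hasMFDerivAt.comp x (he.hasMFDerivAt_id x)
  rw [h] at h₁
  have hcomp := hasMFDerivAt_unique h₁ h₂
  exact hcomp

theorem mpullback_apply [IsManifold 𝓘(𝕜, E) 1 M] (he : IsGlobalChart e)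
    (V : (y : E) → TangentSpace 𝓘(𝕜, E) y) (x : M) :
    (VectorField.mpullback 𝓘(𝕜, E) 𝓘(𝕜, E) e V x : E) = V (e x) := by
  have h : VectorField.mpullback 𝓘(𝕜, E) 𝓘(𝕜, E) e V x =
      (ContinuousLinearMap.id 𝕜 E).inverse (V (e x)) := by
    rw [VectorField.mpullback_apply, (he.hasMFDerivAt_id x).mfderiv]; rfl
  exact h.trans (by rw [ContinuousLinearMap.inverse_id]; rfl)

theorem mlieBracket_eq [CompleteSpace E] [IsManifold 𝓘(𝕜, E) ω M] (he : IsGlobalChart e)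
    {V W : (x : M) → TangentSpace 𝓘(𝕜, E) x} {V' W' : E → E}
    (hV : ∀ x, (V x : E) = V' (e x)) (hW : ∀ x, (W x : E) = W' (e x))
    (hV' : ContDiff 𝕜 1 V') (hW' : ContDiff 𝕜 1 W') (x : M) :
    (VectorField.mlieBracket 𝓘(𝕜, E) V W x : E) = VectorField.lieBracket 𝕜 V' W' (e x) := by
  have : IsManifold 𝓘(𝕜, E) 1 M := .of_le (n := ω) le_top
  have hVp : V = VectorField.mpullback 𝓘(𝕜, E) 𝓘(𝕜, E) e V' :=
    funext fun y => (hV y).trans (he.mpullback_apply V' y).symm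
  have hWp : W = VectorField.mpullback 𝓘(𝕜, E) 𝓘(𝕜, E) e W' :=
    funext fun y => (hW y).trans (he.mpullback_apply W' y).symm
  rw [hVp, hWp, ← VectorField.mpullback_mlieBracket (n := ω)
    ((contMDiff_vectorSpace_iff_contDiff.2 hV').mdifferentiable one_ne_zero _)
    ((contMDiff_vectorSpace_iff_contDiff.2 hW').mdifferentiable one_ne_zero _)
    he.contMDiff.contMDiffAt le_top]
  refine (he.mpullback_apply _ x).trans ?_
  exact mlieBracket_eq_lieBracket V' W' (e x)

end IsGlobalChart

end GlobalChart

section Haar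

variable {G : Type*} [Group G] [TopologicalSpace G] [IsTopologicalGroup G] [LocallyCompactSpace G]
  [MeasurableSpace G] [BorelSpace G]

theorem isOpen_of_measure_ne_zero (μ : Measure G) [μ.IsHaarMeasure] [μ.InnerRegular]
    {H : Subgroup G} (hH : MeasurableSet (H : Set G)) (hμ : μ H ≠ 0) : IsOpen (H : Set G) := by
  have hdiv : (H : Set G) / H ∈ 𝓝 1 := μ.div_mem_nhds_one_of_haar_pos H hH hμ.bot_lt
  refine H.isOpen_of_mem_nhds (Filter.mem_of_superset hdiv ?_)
  rintro _ ⟨a, ha, b, hb, rfl⟩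
  exact H.div_mem ha hb

end Haar

section DilationGroup

variable {𝕜 : Type*} [NontriviallyNormedField 𝕜]
  {E : Type*} [NormedAddCommGroup E] [NormedSpace 𝕜 E]

/-- For a linear form `ℓ` on `E`, the open set of all `p : E` with `1 + ℓ p ≠ 0`. It is a Lie group
for `p * q = p + (1 + ℓ p) • q`, which is the composition of the dilations
`x ↦ p + (1 + ℓ p) • x` of `E`; the inclusion `toVec` into `E` serves as a global chart. -/
@[ext] structure DilationGroup (ℓ : E →L[𝕜] 𝕜) where
  toVec : E
  one_add_ne_zero : 1 + ℓ toVec ≠ 0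

namespace DilationGroup

variable {ℓ : E →L[𝕜] 𝕜}

theorem one_add_mul (p q : E) : 1 + ℓ (p + (1 + ℓ p) • q) = (1 + ℓ p) * (1 + ℓ q) := by
  simp only [map_add, map_smul, smul_eq_mul]; ring

theorem one_add_inv {p : E} (hp : 1 + ℓ p ≠ 0) :
    1 + ℓ (-((1 + ℓ p)⁻¹ • p)) = (1 + ℓ p)⁻¹ := by
  simp only [map_neg, map_smul, smul_eq_mul]; field_simp; ring

instance : Mul (DilationGroup ℓ) :=
  ⟨fun p q => ⟨p.toVec + (1 + ℓ p.toVec) • q.toVec, by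
    rw [one_add_mul]; exact mul_ne_zero p.one_add_ne_zero q.one_add_ne_zero⟩⟩

instance : One (DilationGroup ℓ) := ⟨⟨0, by simp⟩⟩

instance : Inv (DilationGroup ℓ) :=
  ⟨fun p => ⟨-((1 + ℓ p.toVec)⁻¹ • p.toVec), by
    rw [one_add_inv p.one_add_ne_zero]; exact inv_ne_zero p.one_add_ne_zero⟩⟩

theorem toVec_mul (p q : DilationGroup ℓ) :
    (p * q).toVec = p.toVec + (1 + ℓ p.toVec) • q.toVec := rfl

theorem toVec_one : (1 : DilationGroup ℓ).toVec = 0 := rfl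

theorem toVec_inv (p : DilationGroup ℓ) : p⁻¹.toVec = -((1 + ℓ p.toVec)⁻¹ • p.toVec) := rfl

instance : Group (DilationGroup ℓ) :=
  Group.ofLeftAxioms
    (fun p q r => by ext; simp only [toVec_mul, one_add_mul]; module)
    (fun p => by ext; simp [toVec_mul, toVec_one])
    (fun p => by
      ext
      rw [toVec_mul, toVec_inv, one_add_inv p.one_add_ne_zero, toVec_one, neg_add_cancel])

theorem toVec_inv_mul (p q : DilationGroup ℓ) :
    (p⁻¹ * q).toVec = (1 + ℓ p.toVec)⁻¹ • (q.toVec - p.toVec) := by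
  rw [toVec_mul, toVec_inv, one_add_inv p.one_add_ne_zero, smul_sub, sub_eq_neg_add]

section Manifold

instance : TopologicalSpace (DilationGroup ℓ) := .induced toVec inferInstance

theorem isOpenEmbedding_toVec : IsOpenEmbedding (toVec : DilationGroup ℓ → E) := by
  have hrange : Set.range (toVec : DilationGroup ℓ → E) = {p | 1 + ℓ p ≠ 0} :=
    Set.Subset.antisymm (Set.range_subset_iff.2 one_add_ne_zero) fun p hp => ⟨⟨p, hp⟩, rfl⟩
  exact ⟨⟨⟨rfl⟩, fun _ _ => DilationGroup.ext⟩,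
    hrange ▸ isOpen_ne_fun (by fun_prop) continuous_const⟩

@[fun_prop] theorem continuous_toVec : Continuous (toVec : DilationGroup ℓ → E) :=
  isOpenEmbedding_toVec.continuous

noncomputable instance : ChartedSpace E (DilationGroup ℓ) :=
  isOpenEmbedding_toVec.singletonChartedSpace

instance {n : WithTop ℕ∞} : IsManifold 𝓘(𝕜, E) n (DilationGroup ℓ) :=
  isOpenEmbedding_toVec.isManifold_singleton

theorem isGlobalChart_toVec : IsGlobalChart (toVec : DilationGroup ℓ → E) := fun _ => rfl

theorem contMDiff_of_toVec_comp {E₀ : Type*} [NormedAddCommGroup E₀] [NormedSpace 𝕜 E₀]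
    {H₀ : Type*} [TopologicalSpace H₀] {I : ModelWithCorners 𝕜 E₀ H₀}
    {M : Type*} [TopologicalSpace M] [ChartedSpace H₀ M] {n : WithTop ℕ∞} {f : M → DilationGroup ℓ}
    (hf : ContMDiff I 𝓘(𝕜, E) n fun x => (f x).toVec) : ContMDiff I 𝓘(𝕜, E) n f :=
  ContMDiff.of_comp_isOpenEmbedding isOpenEmbedding_toVec hf

instance {n : WithTop ℕ∞} : LieGroup 𝓘(𝕜, E) n (DilationGroup ℓ) where
  contMDiff_mul := by
    have hmul : ContDiff 𝕜 n fun x : E × E => x.1 + (1 + ℓ x.1) • x.2 := by fun_prop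
    have htoVec := isGlobalChart_toVec.contMDiff (𝕜 := 𝕜) (M := DilationGroup ℓ) (n := n)
    exact contMDiff_of_toVec_comp <| hmul.contMDiff.comp <|
      (htoVec.comp contMDiff_fst).prodMk_space (htoVec.comp contMDiff_snd)
  contMDiff_inv := by
    refine contMDiff_of_toVec_comp fun p => ?_
    have hscale : ContDiffAt 𝕜 n (fun x : E => (1 + ℓ x)⁻¹) p.toVec :=
      ContDiffAt.inv (by fun_prop) p.one_add_ne_zero
    exact (hscale.smul contDiffAt_id).neg.contMDiffAt.comp p
      isGlobalChart_toVec.contMDiff.contMDiffAt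

instance : TopologicalSpace.MetrizableSpace (DilationGroup ℓ) :=
  isOpenEmbedding_toVec.isEmbedding.metrizableSpace

instance [ProperSpace E] : SecondCountableTopology (DilationGroup ℓ) :=
  isOpenEmbedding_toVec.isEmbedding.secondCountableTopology

instance [ProperSpace E] : LocallyCompactSpace (DilationGroup ℓ) :=
  isOpenEmbedding_toVec.locallyCompactSpace

instance : IsTopologicalGroup (DilationGroup ℓ) :=
  topologicalGroup_of_lieGroup 𝓘(𝕜, E) ω

end Manifold

section LieAlgebra

theorem mulInvariantVectorField_eq (v : GroupLieAlgebra 𝓘(𝕜, E) (DilationGroup ℓ))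
    (p : DilationGroup ℓ) :
    (mulInvariantVectorField v p : E) = (1 + ℓ p.toVec) • (v : E) := by
  have h : mfderiv 𝓘(𝕜, E) 𝓘(𝕜, E) (p * ·) 1 = (1 + ℓ p.toVec) • ContinuousLinearMap.id 𝕜 E :=
    isGlobalChart_toVec.mfderiv_eq isGlobalChart_toVec (F := (p.toVec + (1 + ℓ p.toVec) • ·))
      (contMDiff_mul_left (n := 1).mdifferentiable one_ne_zero 1)
      (funext fun q => toVec_mul p q) (((hasFDerivAt_id _).const_smul _).const_add _)
  exact congrArg (fun L : E →L[𝕜] E => L v) h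

theorem lieBracket_one_add_smul_const (v w : E) :
    VectorField.lieBracket 𝕜 (fun q => (1 + ℓ q) • v) (fun q => (1 + ℓ q) • w) 0 =
      ℓ v • w - ℓ w • v := by
  have hderiv (u : E) : HasFDerivAt (fun q : E => (1 + ℓ q) • u) (ℓ.smulRight u) 0 :=
    (ℓ.hasFDerivAt.const_add 1).smul_const u
  simp [VectorField.lieBracket, (hderiv v).fderiv, (hderiv w).fderiv]

theorem lie_eq [CompleteSpace E] (v w : GroupLieAlgebra 𝓘(𝕜, E) (DilationGroup ℓ)) :
    ⁅v, w⁆ = ℓ v • w - ℓ w • v :=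
  (isGlobalChart_toVec.mlieBracket_eq (mulInvariantVectorField_eq v) (mulInvariantVectorField_eq w)
    (by fun_prop) (by fun_prop) 1).trans (lieBracket_one_add_smul_const (E := E) v w)

/-- If the bracket of `𝔤` is `⁅x, y⁆ = ℓ x • y - ℓ y • x` in a linear coordinate `φ : E ≃ 𝔤`, then
`φ` is an isomorphism from the Lie algebra of `DilationGroup ℓ` onto `𝔤`. -/
noncomputable def groupLieAlgebraEquiv [CompleteSpace E] {𝔤 : Type*} [LieRing 𝔤] [LieAlgebra 𝕜 𝔤]
    (φ : E ≃ₗ[𝕜] 𝔤) (hφ : ∀ v w, ⁅φ v, φ w⁆ = ℓ v • φ w - ℓ w • φ v) :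
    GroupLieAlgebra 𝓘(𝕜, E) (DilationGroup ℓ) ≃ₗ⁅𝕜⁆ 𝔤 :=
  { φ with
    map_lie' := fun {v w} =>
      have h (v w : E) : φ (ℓ v • w - ℓ w • v) = ⁅φ v, φ w⁆ := by
        rw [hφ, map_sub, map_smul, map_smul]
      (congrArg φ (lie_eq v w)).trans (h v w) }

end LieAlgebra

section Subspace

/-- The closed subgroup of `DilationGroup ℓ` cut out by the subspace `F` of `E`; its Lie algebra
is `F`. -/
def subspaceSubgroup (ℓ : E →L[𝕜] 𝕜) (F : Submodule 𝕜 E) : Subgroup (DilationGroup ℓ) where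
  carrier := toVec ⁻¹' F
  mul_mem' hp hq := F.add_mem hp (F.smul_mem _ hq)
  one_mem' := F.zero_mem
  inv_mem' hp := F.neg_mem (F.smul_mem _ hp)

variable {F F₁ F₂ : Submodule 𝕜 E}

theorem mem_subspaceSubgroup {p : DilationGroup ℓ} : p ∈ subspaceSubgroup ℓ F ↔ p.toVec ∈ F :=
  Iff.rfl

theorem subspaceSubgroup_inf :
    subspaceSubgroup ℓ (F₁ ⊓ F₂) = subspaceSubgroup ℓ F₁ ⊓ subspaceSubgroup ℓ F₂ := rfl

theorem subspaceSubgroup_bot : subspaceSubgroup ℓ ⊥ = ⊥ := by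
  ext p
  exact ⟨fun hp => DilationGroup.ext hp, by rintro rfl; rfl⟩

theorem mem_subspaceSubgroup_mul {p : DilationGroup ℓ} {x y : E} (hp : x + y = p.toVec)
    (hx : x ∈ F₁) (hy : y ∈ F₂) (hℓ : 1 + ℓ x ≠ 0) :
    p ∈ (subspaceSubgroup ℓ F₁ : Set (DilationGroup ℓ)) * subspaceSubgroup ℓ F₂ := by
  let a : DilationGroup ℓ := ⟨x, hℓ⟩
  refine ⟨a, hx, a⁻¹ * p, ?_, mul_inv_cancel_left a p⟩
  have hsub : p.toVec - a.toVec = y := sub_eq_of_eq_add' hp.symm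
  rw [SetLike.mem_coe, mem_subspaceSubgroup, toVec_inv_mul, hsub]
  exact F₂.smul_mem _ hy

end Subspace

section Haar

variable [ProperSpace E] [MeasurableSpace (DilationGroup ℓ)] [BorelSpace (DilationGroup ℓ)]
  (μ : Measure (DilationGroup ℓ)) [μ.IsHaarMeasure]

theorem measure_subspaceSubgroup_eq_zero {F : Submodule 𝕜 E} (hF : IsClosed (F : Set E))
    (hF' : F ≠ ⊤) : μ (subspaceSubgroup ℓ F) = 0 := by
  by_contra h
  have hopen : IsOpen (toVec '' (subspaceSubgroup ℓ F : Set (DilationGroup ℓ))) :=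
    isOpenEmbedding_toVec.isOpenMap _ <|
      isOpen_of_measure_ne_zero μ (hF.preimage continuous_toVec).measurableSet h
  refine hF' (F.eq_top_of_nonempty_interior' ⟨0, mem_interior.2 ⟨_, ?_, hopen, ?_⟩⟩)
  · exact Set.image_preimage_subset _ _
  · exact ⟨1, one_mem (subspaceSubgroup ℓ F), rfl⟩

theorem measure_hyperplane_eq_zero (f : E →L[𝕜] 𝕜) {c : 𝕜} (hc : c ≠ 0) :
    μ {p | f p.toVec = c} = 0 := by
  obtain hempty | ⟨p₀, hp₀⟩ := {p : DilationGroup ℓ | f p.toVec = c}.eq_empty_or_nonempty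
  · rw [hempty, measure_empty]
  have hcoset : {p : DilationGroup ℓ | f p.toVec = c} =
      (p₀⁻¹ * ·) ⁻¹' (subspaceSubgroup ℓ f.ker : Set (DilationGroup ℓ)) := by
    ext p
    rw [Set.mem_preimage, SetLike.mem_coe, mem_subspaceSubgroup, toVec_inv_mul,
      Submodule.smul_mem_iff _ (inv_ne_zero p₀.one_add_ne_zero), LinearMap.mem_ker]
    simp [sub_eq_zero, show f p₀.toVec = c from hp₀]
  have hker : f.ker ≠ ⊤ := fun htop =>
    hc (hp₀.symm.trans (LinearMap.mem_ker.1 (htop ▸ Submodule.mem_top)))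
  rw [hcoset, measure_preimage_mul]
  exact measure_subspaceSubgroup_eq_zero μ f.isClosed_ker hker

theorem measure_compl_subspaceSubgroup_mul_eq_zero {F₁ F₂ : Submodule 𝕜 E}
    (hF : F₁.IsTopCompl F₂) :
    μ ((subspaceSubgroup ℓ F₁ : Set (DilationGroup ℓ)) * subspaceSubgroup ℓ F₂)ᶜ = 0 := by
  let π := F₁.projectionOntoL F₂ hF
  refine measure_mono_null (fun p hp => ?_)
    (measure_hyperplane_eq_zero μ (ℓ ∘L F₁.subtypeL ∘L π) (neg_ne_zero.2 one_ne_zero))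
  have hπ : p.toVec - π p.toVec ∈ F₂ := by
    rw [← Submodule.projectionOntoL_apply_eq_zero_iff hF, map_sub,
      Submodule.projectionOntoL_apply_left, sub_self]
  by_contra h
  exact hp <| mem_subspaceSubgroup_mul (add_sub_cancel _ _) (π p.toVec).2 hπ fun h0 =>
    h (eq_neg_of_add_eq_zero_right h0)

end Haar

end DilationGroup

end DilationGroup

namespace DilationGroup

section Parametrization

variable {𝕜 : Type*} [RCLike 𝕜] {E : Type*} [NormedAddCommGroup E] [NormedSpace 𝕜 E]
  {ℓ : E →L[𝕜] 𝕜}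
  {E₁ : Type*} [NormedAddCommGroup E₁] [NormedSpace 𝕜 E₁]
  {A : Type*} [Group A] [TopologicalSpace A] [ChartedSpace E₁ A]
  {E₂ : Type*} [NormedAddCommGroup E₂] [NormedSpace 𝕜 E₂]
  {B : Type*} [CommGroup B] [TopologicalSpace B] [ChartedSpace E₂ B]

/-- The morphism of Lie groups `i` is an isomorphism onto the closed subgroup
`subspaceSubgroup ℓ F`, on the level of Lie algebras too. -/
structure IsParametrization (F : Submodule 𝕜 E) (i : A →* DilationGroup ℓ) : Prop where
  contMDiff : ContMDiff 𝓘(𝕜, E₁) 𝓘(𝕜, E) ω i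
  isClosedEmbedding : IsClosedEmbedding i
  range_eq : i.range = subspaceSubgroup ℓ F
  tangentImage_eq : tangentImage (𝕜 := 𝕜) (E₁ := E₁) i = (F : Set E)

theorem IsParametrization.isMatchedPairLieGroup [ProperSpace E]
    [MeasurableSpace (DilationGroup ℓ)] [BorelSpace (DilationGroup ℓ)]
    {F₁ F₂ : Submodule 𝕜 E} (hF : F₁.IsTopCompl F₂)
    {i : A →* DilationGroup ℓ} {j : B →* DilationGroup ℓ}
    (hi : IsParametrization (E₁ := E₁) F₁ i) (hj : IsParametrization (E₁ := E₂) F₂ j) :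
    IsMatchedPairLieGroup (𝕜 := 𝕜) (E := E) (E₁ := E₁) (E₂ := E₂) i j where
  map_mul_left := i.map_mul
  map_mul_right s t := by rw [mul_comm, j.map_mul]
  contMDiff_left := hi.contMDiff
  contMDiff_right := hj.contMDiff
  isClosedEmbedding_left := hi.isClosedEmbedding
  isClosedEmbedding_right := hj.isClosedEmbedding
  range_inter_range := by
    rw [← MonoidHom.coe_range, ← MonoidHom.coe_range, ← Subgroup.coe_inf, hi.range_eq, hj.range_eq,
      ← subspaceSubgroup_inf, hF.isCompl.inf_eq_bot, subspaceSubgroup_bot, Subgroup.coe_bot]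
  null_compl μ _ := by
    have hprod : (Set.range fun p : A × B => i p.1 * j p.2) =
        (subspaceSubgroup ℓ F₁ : Set (DilationGroup ℓ)) * subspaceSubgroup ℓ F₂ := by
      rw [← hi.range_eq, ← hj.range_eq, MonoidHom.coe_range, MonoidHom.coe_range]
      exact (Set.image2_range _ _ _).symm
    rw [hprod, measure_compl_subspaceSubgroup_mul_eq_zero μ hF]

end Parametrization

section Line

variable {𝕜 : Type*} [RCLike 𝕜] {E : Type*} [NormedAddCommGroup E] [NormedSpace 𝕜 E]
  {ℓ : E →L[𝕜] 𝕜}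

theorem tangentImage_eq_span_singleton {A : Type*} [Group A] [TopologicalSpace A]
    [ChartedSpace 𝕜 A] [IsManifold 𝓘(𝕜, 𝕜) 1 A] {e : A → 𝕜} (he : IsGlobalChart e)
    {i : A → DilationGroup ℓ} (hi : MDifferentiableAt 𝓘(𝕜, 𝕜) 𝓘(𝕜, E) i 1)
    {f : 𝕜 → 𝕜} {f' : 𝕜} (hf : HasDerivAt f f' (e 1)) (hf' : f' ≠ 0)
    {v : E} (h : ∀ x, (i x).toVec = f (e x) • v) :
    tangentImage (𝕜 := 𝕜) (E₁ := 𝕜) i = ((𝕜 ∙ v : Submodule 𝕜 E) : Set E) := by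
  have hderiv := he.mfderiv_eq isGlobalChart_toVec hi (F := fun s => f s • v) (funext h)
    (hf.smul_const v).hasFDerivAt
  rw [← Submodule.span_singleton_smul_eq hf'.isUnit v, ← LinearMap.range_toSpanSingleton]
  exact congrArg (fun L : 𝕜 →L[𝕜] E => Set.range L) hderiv

/-- The morphism `s ↦ s • v` of `(𝕜, +)` onto the line spanned by `v`, for `ℓ v = 0`. -/
def addLine (v : E) (hv : ℓ v = 0) : Multiplicative 𝕜 →* DilationGroup ℓ :=
  MonoidHom.mk' (fun s => ⟨s.toAdd • v, by simp [hv]⟩) fun s t => by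
    ext
    simp [toVec_mul, hv, add_smul]

/-- The morphism of `(𝕜 ∖ {0}, ·)` onto the part in `DilationGroup ℓ` of the line spanned by `v`,
for `ℓ v ≠ 0`. It is inverse to the character `1 + ℓ`. -/
noncomputable def mulLine (v : E) (hv : ℓ v ≠ 0) : 𝕜ˣ →* DilationGroup ℓ :=
  MonoidHom.mk' (fun u => ⟨(((u : 𝕜) - 1) / ℓ v) • v, by simp [hv]⟩) fun s t => by
    ext
    simp only [toVec_mul, Units.val_mul, map_smul, smul_eq_mul, div_mul_cancel₀ _ hv]
    module

theorem toVec_addLine {v : E} (hv : ℓ v = 0) (s : Multiplicative 𝕜) :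
    (addLine v hv s).toVec = s.toAdd • v := rfl

theorem toVec_mulLine {v : E} (hv : ℓ v ≠ 0) (u : 𝕜ˣ) :
    (mulLine v hv u).toVec = (((u : 𝕜) - 1) / ℓ v) • v := rfl

theorem isParametrization_addLine {v : E} (hv : ℓ v = 0) (hv₀ : v ≠ 0) :
    IsParametrization (E₁ := 𝕜) (𝕜 ∙ v) (addLine v hv) := by
  have hsmooth : ContMDiff 𝓘(𝕜, 𝕜) 𝓘(𝕜, E) ω (addLine v hv) :=
    contMDiff_of_toVec_comp <|
      (by fun_prop : ContDiff 𝕜 ω fun s : 𝕜 => s • v).contMDiff.comp contMDiff_toAdd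
  obtain ⟨g, hg⟩ := SeparatingDual.exists_eq_one (R := 𝕜) hv₀
  refine ⟨hsmooth, ?_, ?_, ?_⟩
  · refine Function.LeftInverse.isClosedEmbedding
      (f := fun p => Multiplicative.ofAdd (g p.toVec)) (fun s => ?_) ?_ hsmooth.continuous
    · simp [toVec_addLine, hg]
    · exact continuous_ofAdd.comp (g.continuous.comp continuous_toVec)
  · ext p
    rw [mem_subspaceSubgroup, Submodule.mem_span_singleton]
    exact ⟨fun ⟨s, hs⟩ => ⟨s.toAdd, hs ▸ rfl⟩,
      fun ⟨s, hs⟩ => ⟨Multiplicative.ofAdd s, DilationGroup.ext hs⟩⟩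
  · exact tangentImage_eq_span_singleton (e := Multiplicative.toAdd) (fun _ => rfl)
      (hsmooth.mdifferentiable (by simp) 1) (hasDerivAt_id _) one_ne_zero (toVec_addLine hv)

theorem isParametrization_mulLine {v : E} (hv : ℓ v ≠ 0) :
    IsParametrization (E₁ := 𝕜) (𝕜 ∙ v) (mulLine v hv) := by
  have hsmooth : ContMDiff 𝓘(𝕜, 𝕜) 𝓘(𝕜, E) ω (mulLine v hv) :=
    contMDiff_of_toVec_comp <|
      (by fun_prop : ContDiff 𝕜 ω fun s : 𝕜 => ((s - 1) / ℓ v) • v).contMDiff.comp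
        Units.contMDiff_val
  refine ⟨hsmooth, ?_, ?_, ?_⟩
  · refine Function.LeftInverse.isClosedEmbedding
      (f := fun p => Units.mk0 (1 + ℓ p.toVec) p.one_add_ne_zero) (fun u => ?_) ?_
      hsmooth.continuous
    · ext
      simp [toVec_mulLine, hv]
    · refine Units.isOpenEmbedding_val.isEmbedding.continuous_iff.2 ?_
      exact continuous_const.add (ℓ.continuous.comp continuous_toVec)
  · ext p
    rw [mem_subspaceSubgroup, Submodule.mem_span_singleton]
    refine ⟨fun ⟨u, hu⟩ => ⟨((u : 𝕜) - 1) / ℓ v, hu ▸ rfl⟩, fun ⟨s, hs⟩ =>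
      ⟨Units.mk0 (1 + ℓ p.toVec) p.one_add_ne_zero, DilationGroup.ext ?_⟩⟩
    simp [toVec_mulLine, ← hs, hv]
  · exact tangentImage_eq_span_singleton (e := Units.val) (fun _ => rfl)
      (hsmooth.mdifferentiable (by simp) 1) (((hasDerivAt_id _).sub_const 1).div_const _)
      (one_div_ne_zero hv) (toVec_mulLine hv)

theorem exists_isParametrization (ℓ : E →L[𝕜] 𝕜) {F : Submodule 𝕜 E}
    (hF : Module.finrank 𝕜 F = 1) :
    (∃ i : Multiplicative 𝕜 →* DilationGroup ℓ, IsParametrization (E₁ := 𝕜) F i) ∨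
      ∃ i : 𝕜ˣ →* DilationGroup ℓ, IsParametrization (E₁ := 𝕜) F i := by
  obtain ⟨v, hv₀, rfl⟩ : ∃ v : E, v ≠ 0 ∧ F = 𝕜 ∙ v := by
    obtain ⟨v, hv₀, hspan⟩ := finrank_eq_one_iff'.1 hF
    refine ⟨v, by simpa using hv₀, le_antisymm (fun w hw => ?_) ?_⟩
    · obtain ⟨c, hc⟩ := hspan ⟨w, hw⟩
      exact Submodule.mem_span_singleton.2 ⟨c, congrArg Subtype.val hc⟩
    · exact (Submodule.span_singleton_le_iff_mem _ _).2 v.2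
  by_cases hv : ℓ v = 0
  · exact .inl ⟨addLine v hv, isParametrization_addLine hv hv₀⟩
  · exact .inr ⟨mulLine v hv, isParametrization_mulLine hv⟩

end Line

section Exponentiation

variable {𝕜 : Type} [RCLike 𝕜] {𝔤 : Type*} [LieRing 𝔤] [LieAlgebra 𝕜 𝔤] {𝔤₁ 𝔤₂ : LieSubalgebra 𝕜 𝔤}

theorem IsParametrization.exponentiatesTo {E : Type} [NormedAddCommGroup E] [NormedSpace 𝕜 E]
    [FiniteDimensional 𝕜 E] {ℓ : E →L[𝕜] 𝕜}
    {E₁ : Type*} [NormedAddCommGroup E₁] [NormedSpace 𝕜 E₁]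
    {A : Type*} [Group A] [TopologicalSpace A] [ChartedSpace E₁ A] [LieGroup 𝓘(𝕜, E₁) ω A]
    {E₂ : Type*} [NormedAddCommGroup E₂] [NormedSpace 𝕜 E₂]
    {B : Type*} [CommGroup B] [TopologicalSpace B] [ChartedSpace E₂ B] [LieGroup 𝓘(𝕜, E₂) ω B]
    (h : IsMatchedPairLieAlgebra 𝔤₁ 𝔤₂) (φ : E ≃ₗ[𝕜] 𝔤)
    (hφ : ∀ v w, ⁅φ v, φ w⁆ = ℓ v • φ w - ℓ w • φ v)
    {i : A →* DilationGroup ℓ} {j : B →* DilationGroup ℓ}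
    (hi : IsParametrization (E₁ := E₁) (𝔤₁.toSubmodule.comap (φ : E →ₗ[𝕜] 𝔤)) i)
    (hj : IsParametrization (E₁ := E₂) (𝔤₂.toSubmodule.comap (φ : E →ₗ[𝕜] 𝔤)) j) :
    ExponentiatesTo 𝔤₁ 𝔤₂ (E₁ := E₁) (E₂ := E₂) A B := by
  have : ProperSpace E := FiniteDimensional.proper_rclike 𝕜 E
  have : CompleteSpace E := FiniteDimensional.complete 𝕜 E
  let : MeasurableSpace (DilationGroup ℓ) := borel _
  have : BorelSpace (DilationGroup ℓ) := ⟨rfl⟩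
  have hF : (𝔤₁.toSubmodule.comap (φ : E →ₗ[𝕜] 𝔤)).IsTopCompl
      (𝔤₂.toSubmodule.comap (φ : E →ₗ[𝕜] 𝔤)) :=
    Submodule.IsCompl.isTopCompl_of_isClosed_of_finiteDimensional
      ((Submodule.orderIsoMapComap φ).symm.isCompl h) (Submodule.closed_of_finiteDimensional _)
  refine ⟨E, inferInstance, inferInstance, inferInstance, inferInstance, DilationGroup ℓ,
    inferInstance, inferInstance, inferInstance, inferInstance, inferInstance, inferInstance,
    inferInstance, inferInstance, i, j, groupLieAlgebraEquiv φ hφ,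
    hi.isMatchedPairLieGroup hF hj, ?_, ?_⟩
  · rw [hi.tangentImage_eq]
    exact φ.surjective.image_preimage 𝔤₁
  · rw [hj.tangentImage_eq]
    exact φ.surjective.image_preimage 𝔤₂

end Exponentiation

end DilationGroup

section Exponentiation

variable {𝕜 : Type} [RCLike 𝕜] {𝔤 : Type*} [LieRing 𝔤] [LieAlgebra 𝕜 𝔤] {𝔤₁ 𝔤₂ : LieSubalgebra 𝕜 𝔤}

theorem IsMatchedPairLieAlgebra.exponentiatesToAddOrMul (h : IsMatchedPairLieAlgebra 𝔤₁ 𝔤₂)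
    (h₁ : Module.finrank 𝕜 𝔤₁ = 1) (h₂ : Module.finrank 𝕜 𝔤₂ = 1) :
    ExponentiatesToAddOrMul 𝔤₁ 𝔤₂ := by
  have : FiniteDimensional 𝕜 𝔤₁ := Module.finite_of_finrank_eq_succ h₁
  have : FiniteDimensional 𝕜 𝔤₂ := Module.finite_of_finrank_eq_succ h₂
  have hrank : Module.finrank 𝕜 𝔤 = 2 := by rw [← h.finrank_add_finrank, h₁, h₂]
  obtain ⟨ℓ₀, hℓ₀⟩ := exists_lie_eq_smul_sub_smul hrank
  have : FiniteDimensional 𝕜 𝔤 := Module.finite_of_finrank_eq_succ hrank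
  let φ : (𝕜 × 𝕜) ≃ₗ[𝕜] 𝔤 := LinearEquiv.ofFinrankEq _ _ (by simp [hrank])
  let ℓ : 𝕜 × 𝕜 →L[𝕜] 𝕜 := (ℓ₀ ∘ₗ (φ : 𝕜 × 𝕜 →ₗ[𝕜] 𝔤)).toContinuousLinearMap
  have hφ (v w : 𝕜 × 𝕜) : ⁅φ v, φ w⁆ = ℓ v • φ w - ℓ w • φ v := hℓ₀ (φ v) (φ w)
  have finrank_comap {𝔥 : LieSubalgebra 𝕜 𝔤} (h𝔥 : Module.finrank 𝕜 𝔥 = 1) :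
      Module.finrank 𝕜 (𝔥.toSubmodule.comap (φ : 𝕜 × 𝕜 →ₗ[𝕜] 𝔤)) = 1 := by
    rw [Submodule.comap_equiv_eq_map_symm, LinearEquiv.finrank_map_eq]; exact h𝔥
  obtain ⟨i, hi⟩ | ⟨i, hi⟩ := DilationGroup.exists_isParametrization ℓ (finrank_comap h₁) <;>
  obtain ⟨j, hj⟩ | ⟨j, hj⟩ := DilationGroup.exists_isParametrization ℓ (finrank_comap h₂)
  · exact .inl (hi.exponentiatesTo h φ hφ hj)
  · exact .inr (.inl (hi.exponentiatesTo h φ hφ hj))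
  · exact .inr (.inr (.inl (hi.exponentiatesTo h φ hφ hj)))
  · exact .inr (.inr (.inr (hi.exponentiatesTo h φ hφ hj)))

end Exponentiation

end LieMatchedPair

theorem mainTheorem9 :
    (∀ (𝔤 : Type*) [LieRing 𝔤] [LieAlgebra ℂ 𝔤] (𝔤₁ 𝔤₂ : LieSubalgebra ℂ 𝔤),
      LieMatchedPair.IsMatchedPairLieAlgebra 𝔤₁ 𝔤₂ →
      Module.finrank ℂ 𝔤₁ = 1 → Module.finrank ℂ 𝔤₂ = 1 →
      LieMatchedPair.ExponentiatesToAddOrMul 𝔤₁ 𝔤₂) ∧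
    (∀ (𝔤 : Type*) [LieRing 𝔤] [LieAlgebra ℝ 𝔤] (𝔤₁ 𝔤₂ : LieSubalgebra ℝ 𝔤),
      LieMatchedPair.IsMatchedPairLieAlgebra 𝔤₁ 𝔤₂ →
      Module.finrank ℝ 𝔤₁ = 1 → Module.finrank ℝ 𝔤₂ = 1 →
      LieMatchedPair.ExponentiatesToAddOrMul 𝔤₁ 𝔤₂) :=
  ⟨fun _ _ _ _ _ h h₁ h₂ => h.exponentiatesToAddOrMul h₁ h₂,
    fun _ _ _ _ _ h h₁ h₂ => h.exponentiatesToAddOrMul h₁ h₂⟩
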